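/- Let $k$ be a field of characteristic $p\ge 0$ and $G$ a finite group. Let $G_p$ be a Sylow $p$-subgroup of $G$ if $p>0$, and $G_p=1$ if $p=0$. Let $M$ be a finite dimensional indecomposable $kG$-module that is not projective. For a $kG$-module $X$ (possibly infinite dimensional), let $J_G(M,X)$ be the set of homomorphisms in $\operatorname{Hom}_{kG}(M,X)$ that are not split injective. It is a $k$-subspace; put $\operatorname{Hom}^{\oplus}_{kG}(M,X)=\operatorname{Hom}_{kG}(M,X)/J_G(M,X)$, which by composition is a functor of $X$ from $kG$-modules to $k$-modules. Then there is an additive functor $F$ from $kG_p$-modules to $k$-modules such that the functor $\operatorname{Hom}^{\oplus}_{kG}(M,-)$ is a direct summand of the functor $X\mapsto F(X{\downarrow}^G_{G_p})$, that is, there are a functor $C$ from $kG$-modules to $k$-modules and a natural isomorphism $F(-{\downarrow}^G_{G_p})\cong \operatorname{Hom}^{\oplus}_{kG}(M,-)\oplus C$. -/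

import Mathlib

open CategoryTheory CategoryTheory.Limits

universe u v w

noncomputable section

namespace HomSummand

/-- `P` is the subgroup `G_p` of `G` for a field of characteristic `p`: a Sylow `p`-subgroup if
`p ≠ 0`, and the trivial subgroup if `p = 0`. -/
def IsSylowAt {G : Type v} [Group G] (p : ℕ) (P : Subgroup G) : Prop :=
  (p = 0 ∧ P = ⊥) ∨ (p ≠ 0 ∧ ∃ Q : Sylow p G, (Q : Subgroup G) = P)

section Local

variable {k : Type u} [Field k] {G : Type v} [Group G]

/-- The endomorphism algebra of a finite dimensional representation is finite dimensional. -/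
theorem finite_end (M : Rep.{w} k G) [Module.Finite k M] : Module.Finite k (End M) := by
  let φ : End M →ₗ[k] (M →ₗ[k] M) :=
    { toFun := fun f => (f : M ⟶ M).hom.toLinearMap
      map_add' := fun _ _ => rfl
      map_smul' := fun _ _ => rfl }
  refine Module.Finite.of_injective φ fun f g h => ?_
  exact Rep.hom_ext (Representation.IntertwiningMap.ext h)

/-- An idempotent endomorphism of an indecomposable representation is `0` or `1`. -/
theorem idem_eq (M : Rep.{w} k G) (hM : Indecomposable M) (e : M ⟶ M) (he : e ≫ e = e) :
    e = 0 ∨ e = 𝟙 M := by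
  obtain ⟨Y, i, r, hir, hri⟩ := IsIdempotentComplete.idempotents_split M e he
  obtain ⟨Z, i', r', hir', hri'⟩ := IsIdempotentComplete.idempotents_split M (𝟙 M - e)
    (Idempotents.idem_of_id_sub_idem e he)
  have h1 : i ≫ r' = 0 := by
    have h : i ≫ (r' ≫ i') = 0 := by
      rw [hri', Preadditive.comp_sub, ← hri, ← Category.assoc, hir]; simp
    have h' := congrArg (· ≫ r') h
    simpa [hir'] using h'
  have h2 : i' ≫ r = 0 := by
    have h : i' ≫ (r ≫ i) = 0 := by
      have : r ≫ i = 𝟙 M - (r' ≫ i') := by rw [hri, hri']; abel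
      rw [this, Preadditive.comp_sub, ← Category.assoc, hir']; simp
    have h' := congrArg (· ≫ r) h
    simpa [hir] using h'
  let φ : M ≅ Y ⊞ Z :=
    { hom := biprod.lift r r'
      inv := biprod.desc i i'
      hom_inv_id := by rw [biprod.lift_desc, hri, hri']; abel
      inv_hom_id := by
        apply biprod.hom_ext' <;> apply biprod.hom_ext <;> simp [hir, hir', h1, h2] }
  rcases hM.2 Y Z φ with h | h
  · left
    rw [← hri, h.eq_of_tgt r 0, zero_comp]
  · right
    have : 𝟙 M - e = 0 := by rw [← hri', h.eq_of_tgt r' 0, zero_comp]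
    exact (sub_eq_zero.mp this).symm

/-- In a finite dimensional algebra whose only idempotents are `0` and `1`, every `a` satisfies that
`a` or `1 - a` is invertible. -/
theorem isUnit_or_of_idem {A : Type*} [Ring A] [Algebra k A] [Module.Finite k A]
    (hA : ∀ e : A, e * e = e → e = 0 ∨ e = 1) (a : A) : IsUnit a ∨ IsUnit (1 - a) := by
  have hp : minpoly k a ≠ 0 := minpoly.ne_zero (Algebra.IsIntegral.isIntegral a)
  obtain ⟨q, hq, hnd⟩ := Polynomial.exists_eq_pow_rootMultiplicity_mul_and_not_dvd
    (minpoly k a) hp 0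
  generalize Polynomial.rootMultiplicity 0 (minpoly k a) = m at hq
  rw [Polynomial.C_0, sub_zero] at hq hnd
  have hcop : IsCoprime (Polynomial.X ^ (m + 1) : Polynomial k) q :=
    ((Polynomial.irreducible_X.coprime_iff_not_dvd).2 hnd).pow_left
  obtain ⟨s, t, hst⟩ := hcop
  have h0 : a ^ (m + 1) * Polynomial.aeval a q = 0 := by
    have := minpoly.aeval k a
    rw [hq] at this
    rw [pow_succ', mul_assoc]
    simpa using congrArg (a * ·) this
  have h1 : Polynomial.aeval a s * a ^ (m + 1) +
      Polynomial.aeval a t * Polynomial.aeval a q = 1 := by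
    simpa using congrArg (Polynomial.aeval a) hst
  have hc : ∀ r r' : Polynomial k, Commute (Polynomial.aeval a r) (Polynomial.aeval a r') :=
    fun r r' => by
      have := congrArg (Polynomial.aeval a) (mul_comm r r')
      simpa [Commute, SemiconjBy] using this
  have hX : ∀ r : Polynomial k, Commute a (Polynomial.aeval a r) := fun r => by
    simpa using hc Polynomial.X r
  have hTQ := hc t q
  have hS := ((hX s).symm).pow_right (m + 1)
  have hQa := ((hX q).pow_left (m + 1)).eq
  have hSa := (hX s).eq
  generalize Polynomial.aeval a s = S at *
  generalize Polynomial.aeval a t = T at *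
  generalize Polynomial.aeval a q = Q at *
  have hQ : T * Q * (S * a ^ (m + 1)) = 0 := by
    rw [hS.eq, mul_assoc, ← mul_assoc Q, ← hQa, h0, zero_mul, mul_zero]
  have hid : (S * a ^ (m + 1)) * (S * a ^ (m + 1)) = S * a ^ (m + 1) := by
    have h := congrArg (· * (S * a ^ (m + 1))) h1
    simp only [add_mul, one_mul] at h
    rwa [hQ, add_zero] at h
  rcases hA _ hid with h | h
  · right
    rw [h, zero_add] at h1
    have hnil : a ^ (m + 1) = 0 := by
      calc a ^ (m + 1) = a ^ (m + 1) * (T * Q) := by rw [h1, mul_one]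
        _ = 0 := by rw [hTQ.eq, ← mul_assoc, h0, zero_mul]
    exact IsNilpotent.isUnit_one_sub ⟨m + 1, hnil⟩
  · left
    refine isUnit_iff_exists.2 ⟨S * a ^ m, ?_, ?_⟩
    · rw [← h, pow_succ', ← mul_assoc, ← mul_assoc, hSa]
    · rw [← h, pow_succ, mul_assoc]

/-- The endomorphism ring of a finite dimensional indecomposable representation is local. -/
theorem split_or (M : Rep.{w} k G) [Module.Finite k M] (hM : Indecomposable M) (a b : M ⟶ M)
    (hab : a + b = 𝟙 M) : IsIso a ∨ IsIso b := by
  have := finite_end M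
  have h := isUnit_or_of_idem (k := k) (A := End M) (fun e he => idem_eq M hM e he) a
  have hb : (1 : End M) - (show End M from a) = b := sub_eq_iff_eq_add'.2 hab.symm
  rw [hb] at h
  exact h.imp (isUnit_iff_isIso a).1 (isUnit_iff_isIso b).1

end Local

section Functor

variable {k : Type u} [Field k] {G : Type v} [Group G]

/-- `J_G(M, X)`: the subspace of `Hom_{kG}(M, X)` formed by the homomorphisms that are not split
injective, for `M` finite dimensional and indecomposable. -/
def nonSplit (M : Rep.{w} k G) [Module.Finite k M] (hM : Indecomposable M) (X : Rep.{w} k G) :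
    Submodule k (M ⟶ X) where
  carrier := {f | ¬ IsSplitMono f}
  zero_mem' := fun h => by
    obtain ⟨⟨r, hr⟩⟩ := h.exists_splitMono
    exact hM.1 ((IsZero.iff_id_eq_zero M).2 (by rw [← hr, zero_comp]))
  add_mem' := fun {f g} hf hg h => by
    obtain ⟨⟨s, hs⟩⟩ := h.exists_splitMono
    rw [Preadditive.add_comp] at hs
    have key : ∀ φ : M ⟶ X, IsIso (φ ≫ s) → IsSplitMono φ := fun φ _ =>
      IsSplitMono.mk' ⟨s ≫ inv (φ ≫ s), by rw [← Category.assoc, IsIso.hom_inv_id]⟩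
    exact (split_or M hM _ _ hs).elim (fun h => hf (key f h)) (fun h => hg (key g h))
  smul_mem' := fun c f hf h => by
    obtain ⟨⟨s, hs⟩⟩ := h.exists_splitMono
    exact hf (IsSplitMono.mk' ⟨c • s, by
      rw [Linear.comp_smul, ← Linear.smul_comp]; exact hs⟩)

/-- `X ↦ Hom_{kG}(M, X) / J_G(M, X)`, as a functor from `kG`-modules to `k`-modules; a
homomorphism `X ⟶ Y` acts by composition. -/
def homOplus (M : Rep.{w} k G) [Module.Finite k M] (hM : Indecomposable M) :
    Rep.{w} k G ⥤ ModuleCat.{w} k where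
  obj X := ModuleCat.of k ((M ⟶ X) ⧸ nonSplit M hM X)
  map {X Y} φ := ModuleCat.ofHom <|
    (nonSplit M hM X).mapQ (nonSplit M hM Y) (Linear.rightComp k M φ) fun f hf h => by
      obtain ⟨⟨s, hs⟩⟩ := h.exists_splitMono
      exact hf (IsSplitMono.mk' ⟨φ ≫ s, by rw [← Category.assoc]; exact hs⟩)
  map_id X := by
    refine ModuleCat.hom_ext (Submodule.linearMap_qext _ (LinearMap.ext fun f => ?_))
    exact congrArg (Submodule.Quotient.mk (p := nonSplit M hM X)) (Category.comp_id f)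
  map_comp φ ψ := by
    refine ModuleCat.hom_ext (Submodule.linearMap_qext _ (LinearMap.ext fun f => ?_))
    exact congrArg (Submodule.Quotient.mk (p := nonSplit M hM _)) (Category.assoc f φ ψ).symm

end Functor

/-- `A` is a direct summand of `B`: there is a complement `C` with `B ≅ A ⊞ C`. -/
def IsDirectSummand {C : Type*} [Category C] [Preadditive C] [HasBinaryBiproducts C]
    (A B : C) : Prop :=
  ∃ A' : C, Nonempty (B ≅ A ⊞ A')

end HomSummand

end

noncomputable section

namespace HomSummand

/-! Restriction to `P` followed by transfer back to `G` is multiplication by the index of `P` on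
`Hom_{kG}(M, X)`, and this index is invertible in `k`. To pass to quotients by non-split maps, take
on `kP`-modules the largest subfunctor `T` of `Hom_{kP}(M, -)` for which transfer sends each `T(X↓)`
into `J_G(M, X)`, and put `F = Hom_{kP}(M, -) / T`. Restriction sends `J_G(M, X)` into `T(X↓)`
because `tr(j↓ ≫ ψ) = j ≫ tr ψ`, and `j ≫ tr ψ` cannot be split injective unless `j` is. Thus
`Hom^⊕` is a retract of `F(-↓)`, and idempotents split in the functor category, so it is a direct
summand. -/

/-- A retract in an idempotent complete preadditive category is a direct summand. -/
theorem IsDirectSummand.of_retract {C : Type*} [Category C] [Preadditive C]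
    [HasBinaryBiproducts C] [IsIdempotentComplete C] {A B : C} (i : A ⟶ B) (r : B ⟶ A)
    (hir : i ≫ r = 𝟙 A) : IsDirectSummand A B := by
  have hidem : (r ≫ i) ≫ (r ≫ i) = r ≫ i := by
    rw [Category.assoc, ← Category.assoc i, hir, Category.id_comp]
  -- The complement is the image of the complementary idempotent.
  obtain ⟨Z, i', r', hir', hri'⟩ := IsIdempotentComplete.idempotents_split B (𝟙 B - r ≫ i)
    (Idempotents.idem_of_id_sub_idem _ (by simpa using hidem))
  have h1 : i ≫ r' = 0 := by
    have h : i ≫ (r' ≫ i') = 0 := by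
      rw [hri', Preadditive.comp_sub, ← Category.assoc, hir]; simp
    have h' := congrArg (· ≫ r') h
    simpa [hir'] using h'
  have h2 : i' ≫ r = 0 := by
    have h : (r' ≫ i') ≫ r = 0 := by
      rw [hri', Preadditive.sub_comp, Category.assoc, hir]; simp
    have h' := congrArg (i' ≫ ·) h
    simpa [reassoc_of% hir'] using h'
  exact ⟨Z, ⟨{
    hom := biprod.lift r r'
    inv := biprod.desc i i'
    hom_inv_id := by rw [biprod.lift_desc, hri']; abel
    inv_hom_id := by
      apply biprod.hom_ext' <;> apply biprod.hom_ext <;> simp [hir, hir', h1, h2] }⟩⟩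

/-! ### Transfer from `P` to `G` -/

section Transfer

variable {k : Type u} [Field k] {G : Type v} [Group G] (P : Subgroup G)

/-- The conjugate `g f g⁻¹` of a linear map between representations. -/
def conj (M X : Rep.{w} k G) (g : G) : (M →ₗ[k] X) →ₗ[k] (M →ₗ[k] X) where
  toFun f := X.ρ g ∘ₗ f ∘ₗ M.ρ g⁻¹
  map_add' _ _ := by ext; simp
  map_smul' _ _ := by ext; simp

theorem conj_apply (M X : Rep.{w} k G) (g : G) (f : M →ₗ[k] X) (m : M) :
    conj M X g f m = X.ρ g (f (M.ρ g⁻¹ m)) := rfl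

/-- Since `f` commutes with `P`, a factor `s` in `P` cancels in `(gs) f (gs)⁻¹`. Hence the transfer
does not depend on the coset representatives `q.out`. -/
theorem conj_eq_of_mk_eq {M X : Rep.{w} k G}
    (f : (Rep.resFunctor P.subtype).obj M ⟶ (Rep.resFunctor P.subtype).obj X) {g h : G}
    (hgh : (g : G ⧸ P) = h) :
    conj M X g f.hom.toLinearMap = conj M X h f.hom.toLinearMap := by
  obtain ⟨s, rfl⟩ : ∃ s : P, h = g * s := ⟨⟨g⁻¹ * h, QuotientGroup.eq.1 hgh⟩, by simp⟩
  refine LinearMap.ext fun m => ?_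
  have hs : ∀ x : M, f.hom (M.ρ (s : G) x) = X.ρ (s : G) (f.hom x) :=
    fun x => Rep.hom_comm_apply f s x
  have hm : M.ρ g⁻¹ m = M.ρ (s : G) (M.ρ (g * s)⁻¹ m) := by
    rw [← Module.End.mul_apply, ← map_mul]; simp
  change X.ρ g (f.hom (M.ρ g⁻¹ m)) = X.ρ (g * s) (f.hom (M.ρ (g * s)⁻¹ m))
  rw [hm, hs, map_mul, Module.End.mul_apply]

theorem conj_mul_apply (M X : Rep.{w} k G) (g h : G) (f : M →ₗ[k] X) (m : M) :
    conj M X (h * g) f (M.ρ h m) = X.ρ h (conj M X g f m) := by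
  have hm : M.ρ g⁻¹ m = M.ρ (h * g)⁻¹ (M.ρ h m) := by
    rw [← Module.End.mul_apply, ← map_mul]; simp
  rw [conj_apply, conj_apply, hm, map_mul, Module.End.mul_apply]

variable [P.FiniteIndex]

/-- The linear map underlying the transfer: the sum of the conjugates of `f` over the cosets
of `P`. -/
def transferLinear (M X : Rep.{w} k G) : (M →ₗ[k] X) →ₗ[k] (M →ₗ[k] X) :=
  letI := P.fintypeQuotientOfFiniteIndex
  ∑ q : G ⧸ P, conj M X q.out

theorem transferLinear_apply (M X : Rep.{w} k G) (f : M →ₗ[k] X) (m : M) :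
    letI := P.fintypeQuotientOfFiniteIndex
    transferLinear P M X f m = ∑ q : G ⧸ P, conj M X q.out f m := by
  simp [transferLinear, LinearMap.sum_apply]

/-- The transfer `Hom_{kP}(M, X) → Hom_{kG}(M, X)`. -/
def transfer (M X : Rep.{w} k G) :
    ((Rep.resFunctor P.subtype).obj M ⟶ (Rep.resFunctor P.subtype).obj X) →ₗ[k] (M ⟶ X) where
  toFun f := Rep.ofHom (LinearMap.intertwiningMap_of_isIntertwiningMap M.ρ X.ρ
    (transferLinear P M X f.hom.toLinearMap) fun h m => by
      let := P.fintypeQuotientOfFiniteIndex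
      rw [transferLinear_apply, transferLinear_apply, map_sum,
        ← Equiv.sum_comp (MulAction.toPerm h)]
      refine Finset.sum_congr rfl fun q _ => ?_
      rw [← conj_mul_apply]
      -- `(h • q).out` and `h * q.out` may differ, but they represent the same coset.
      refine LinearMap.congr_fun (conj_eq_of_mk_eq P f ?_) _
      rw [QuotientGroup.out_eq', MulAction.toPerm_apply]
      conv_lhs => rw [← QuotientGroup.out_eq' q]
      rfl)
  map_add' f g := Rep.hom_ext <| Representation.IntertwiningMap.ext <|
    (transferLinear P M X).map_add f.hom.toLinearMap g.hom.toLinearMap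
  map_smul' c f := Rep.hom_ext <| Representation.IntertwiningMap.ext <|
    (transferLinear P M X).map_smul c f.hom.toLinearMap

theorem transfer_apply {M X : Rep.{w} k G}
    (f : (Rep.resFunctor P.subtype).obj M ⟶ (Rep.resFunctor P.subtype).obj X) (m : M) :
    letI := P.fintypeQuotientOfFiniteIndex
    (transfer P M X f).hom m = ∑ q : G ⧸ P, X.ρ q.out (f.hom (M.ρ q.out⁻¹ m)) :=
  transferLinear_apply P M X _ m

theorem transfer_map_comp {M X Y : Rep.{w} k G} (j : M ⟶ X)
    (f : (Rep.resFunctor P.subtype).obj X ⟶ (Rep.resFunctor P.subtype).obj Y) :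
    transfer P M Y ((Rep.resFunctor P.subtype).map j ≫ f) = j ≫ transfer P X Y f := by
  refine Rep.hom_ext (Representation.IntertwiningMap.ext (LinearMap.ext fun m => ?_))
  refine (transfer_apply P _ m).trans (Eq.trans ?_ (transfer_apply P f (j.hom m)).symm)
  refine Finset.sum_congr rfl fun q _ => ?_
  rw [← Rep.hom_comm_apply]
  rfl

theorem transfer_comp_map {M X Y : Rep.{w} k G}
    (f : (Rep.resFunctor P.subtype).obj M ⟶ (Rep.resFunctor P.subtype).obj X) (j : X ⟶ Y) :
    transfer P M Y (f ≫ (Rep.resFunctor P.subtype).map j) = transfer P M X f ≫ j := by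
  refine Rep.hom_ext (Representation.IntertwiningMap.ext (LinearMap.ext fun m => ?_))
  refine (transfer_apply P _ m).trans
    (Eq.trans ?_ (congrArg j.hom (transfer_apply P f m)).symm)
  rw [map_sum]
  refine Finset.sum_congr rfl fun q _ => ?_
  rw [Rep.hom_comm_apply]
  rfl

/-- Each conjugate of a `G`-linear map is the map itself, so the sum has one equal term per coset.
-/
theorem transfer_map {M X : Rep.{w} k G} (j : M ⟶ X) :
    transfer P M X ((Rep.resFunctor P.subtype).map j) = (P.index : k) • j := by
  let := P.fintypeQuotientOfFiniteIndex
  refine Rep.hom_ext (Representation.IntertwiningMap.ext (LinearMap.ext fun m => ?_))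
  refine (transfer_apply P _ m).trans ?_
  have h : ∀ q : G ⧸ P, X.ρ q.out
      (((Rep.resFunctor P.subtype).map j).hom (M.ρ q.out⁻¹ m)) = j.hom m := fun q => by
    change X.ρ q.out (j.hom (M.ρ q.out⁻¹ m)) = _
    rw [Rep.hom_comm_apply, ← Module.End.mul_apply, ← map_mul]; simp
  rw [Finset.sum_congr rfl fun q _ => h q, Finset.sum_const, Finset.card_univ,
    ← Nat.card_eq_fintype_card, ← Nat.cast_smul_eq_nsmul k]
  rfl

end Transfer

/-! ### The functor `F` and the retraction -/

section Functor

variable {k : Type u} [Field k] {G : Type v} [Group G] (P : Subgroup G) [P.FiniteIndex]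
  (M : Rep.{w} k G) [Module.Finite k M] (hM : Indecomposable M)

/-- The `kP`-homomorphisms `M ⟶ Y` all of whose composites with homomorphisms to restricted
`kG`-modules have a transfer that is not split injective. -/
def transferNonSplit (Y : Rep.{w} k P) :
    Submodule k ((Rep.resFunctor P.subtype).obj M ⟶ Y) where
  carrier := {f | ∀ (X : Rep.{w} k G) (ψ : Y ⟶ (Rep.resFunctor P.subtype).obj X),
    transfer P M X (f ≫ ψ) ∈ nonSplit M hM X}
  zero_mem' X ψ := by
    rw [zero_comp, map_zero]
    exact zero_mem _
  add_mem' hf hg X ψ := by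
    rw [Preadditive.add_comp, map_add]
    exact add_mem (hf X ψ) (hg X ψ)
  smul_mem' c f hf X ψ := by
    rw [Linear.smul_comp, map_smul]
    exact Submodule.smul_mem _ c (hf X ψ)

theorem comp_mem_transferNonSplit {Y Z : Rep.{w} k P}
    {f : (Rep.resFunctor P.subtype).obj M ⟶ Y} (hf : f ∈ transferNonSplit P M hM Y)
    (φ : Y ⟶ Z) : f ≫ φ ∈ transferNonSplit P M hM Z := fun X ψ => by
  rw [Category.assoc]
  exact hf X (φ ≫ ψ)

theorem comp_mem_nonSplit {X Y : Rep.{w} k G} {f : M ⟶ X} (hf : f ∈ nonSplit M hM X)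
    (φ : X ⟶ Y) : f ≫ φ ∈ nonSplit M hM Y := fun h => by
  obtain ⟨⟨s, hs⟩⟩ := h.exists_splitMono
  exact hf (IsSplitMono.mk' ⟨φ ≫ s, by rw [← Category.assoc]; exact hs⟩)

theorem map_mem_transferNonSplit {X : Rep.{w} k G} {f : M ⟶ X} (hf : f ∈ nonSplit M hM X) :
    (Rep.resFunctor P.subtype).map f ∈
      transferNonSplit P M hM ((Rep.resFunctor P.subtype).obj X) := fun Z ψ => by
  rw [transfer_map_comp]
  exact comp_mem_nonSplit M hM hf _

theorem transfer_mem_nonSplit {X : Rep.{w} k G}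
    {f : (Rep.resFunctor P.subtype).obj M ⟶ (Rep.resFunctor P.subtype).obj X}
    (hf : f ∈ transferNonSplit P M hM ((Rep.resFunctor P.subtype).obj X)) :
    transfer P M X f ∈ nonSplit M hM X := by
  -- Over a restricted module the identity is an allowed test map `ψ`.
  simpa only [Category.comp_id] using hf X (𝟙 _)

/-- The quotient of `Hom_{kP}(M, -)` by `transferNonSplit`, as a functor from `kP`-modules to
`k`-modules. -/
def transferQuotient : Rep.{w} k P ⥤ ModuleCat.{w} k where
  obj Y := ModuleCat.of k
    (((Rep.resFunctor P.subtype).obj M ⟶ Y) ⧸ transferNonSplit P M hM Y)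
  map {Y Z} φ := ModuleCat.ofHom <|
    (transferNonSplit P M hM Y).mapQ (transferNonSplit P M hM Z) (Linear.rightComp k _ φ)
      fun _ hf => comp_mem_transferNonSplit P M hM hf φ
  map_id Y := by
    refine ModuleCat.hom_ext (Submodule.linearMap_qext _ (LinearMap.ext fun f => ?_))
    exact congrArg (Submodule.Quotient.mk (p := transferNonSplit P M hM Y)) (Category.comp_id f)
  map_comp φ ψ := by
    refine ModuleCat.hom_ext (Submodule.linearMap_qext _ (LinearMap.ext fun f => ?_))
    exact congrArg (Submodule.Quotient.mk (p := transferNonSplit P M hM _))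
      (Category.assoc f φ ψ).symm

theorem transferQuotient_additive : (transferQuotient P M hM).Additive where
  map_add {Y Z φ ψ} := by
    refine ModuleCat.hom_ext (Submodule.linearMap_qext _ (LinearMap.ext fun f => ?_))
    exact congrArg (Submodule.Quotient.mk (p := transferNonSplit P M hM Z))
      (Preadditive.comp_add _ _ _ f φ ψ)

/-- Restriction of homomorphisms from `G` to `P`, modulo the non-split ones. -/
def restrictionTrans :
    homOplus M hM ⟶ Rep.resFunctor P.subtype ⋙ transferQuotient P M hM where
  app X := ModuleCat.ofHom <|
    (nonSplit M hM X).mapQ (transferNonSplit P M hM ((Rep.resFunctor P.subtype).obj X))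
      ((Rep.resFunctor P.subtype).mapLinearMap k) fun _ hf => map_mem_transferNonSplit P M hM hf
  naturality X Y φ := by
    refine ModuleCat.hom_ext (Submodule.linearMap_qext _ (LinearMap.ext fun f => ?_))
    exact congrArg (Submodule.Quotient.mk (p := transferNonSplit P M hM _))
      ((Rep.resFunctor P.subtype).map_comp f φ)

/-- The transfer of homomorphisms from `P` to `G`, modulo the non-split ones. -/
def transferTrans :
    Rep.resFunctor P.subtype ⋙ transferQuotient P M hM ⟶ homOplus M hM where
  app X := ModuleCat.ofHom <|
    (transferNonSplit P M hM ((Rep.resFunctor P.subtype).obj X)).mapQ (nonSplit M hM X)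
      (transfer P M X) fun _ hf => transfer_mem_nonSplit P M hM hf
  naturality X Y φ := by
    refine ModuleCat.hom_ext (Submodule.linearMap_qext _ (LinearMap.ext fun f => ?_))
    exact congrArg (Submodule.Quotient.mk (p := nonSplit M hM _)) (transfer_comp_map P f φ)

theorem restrictionTrans_comp_transferTrans :
    restrictionTrans P M hM ≫ transferTrans P M hM = (P.index : k) • 𝟙 (homOplus M hM) := by
  refine NatTrans.ext (funext fun X => ?_)
  refine ModuleCat.hom_ext (Submodule.linearMap_qext _ (LinearMap.ext fun f => ?_))
  exact congrArg (Submodule.Quotient.mk (p := nonSplit M hM _)) (transfer_map P f)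

theorem isDirectSummand_homOplus (hP : (P.index : k) ≠ 0) :
    IsDirectSummand (homOplus M hM)
      (Rep.resFunctor P.subtype ⋙ transferQuotient P M hM) :=
  IsDirectSummand.of_retract (restrictionTrans P M hM)
    ((P.index : k)⁻¹ • transferTrans P M hM) <| by
      rw [Linear.comp_smul, restrictionTrans_comp_transferTrans, smul_smul,
        inv_mul_cancel₀ hP, one_smul]

end Functor

/-- A Sylow `p`-subgroup has index prime to `p`; in characteristic zero a finite nonzero index
suffices. -/
theorem IsSylowAt.index_ne_zero {k : Type u} [Field k] {p : ℕ} [CharP k p] {G : Type v} [Group G]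
    [Finite G] {P : Subgroup G} (hP : IsSylowAt p P) : (P.index : k) ≠ 0 := by
  rw [Ne, CharP.cast_eq_zero_iff k p]
  rcases hP with ⟨rfl, -⟩ | ⟨hp, Q, rfl⟩
  · rw [zero_dvd_iff]
    exact Subgroup.index_ne_zero_of_finite
  · have : Fact p.Prime := ⟨(CharP.char_is_prime_or_zero k p).resolve_right hp⟩
    exact Q.not_dvd_index

end HomSummand

end

theorem proposition6p7 {k : Type u} [Field k] (p : ℕ) [CharP k p]
    {G : Type v} [Group G] [Finite G]
    (P : Subgroup G) (hP : HomSummand.IsSylowAt p P)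
    (M : Rep.{w} k G) [Module.Finite k M] (hM : Indecomposable M) (hproj : ¬ Projective M) :
    ∃ F : Rep.{w} k P ⥤ ModuleCat.{w} k, F.Additive ∧
      HomSummand.IsDirectSummand (HomSummand.homOplus M hM)
        (Rep.resFunctor P.subtype ⋙ F) :=
  ⟨HomSummand.transferQuotient P M hM, HomSummand.transferQuotient_additive P M hM,
    HomSummand.isDirectSummand_homOplus P M hM hP.index_ne_zero⟩
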